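/- For a permutation $\pi=\pi_1\pi_2\cdots\pi_n$ in the symmetric group $\mathcal{S}_n$ of $\{1,\dots,n\}$ let \[ D(\pi)=\{i: 1\le i<n,\ \pi_i>\pi_{i+1}\},\qquad \mathrm{des}\,\pi=|D(\pi)|,\qquad \mathrm{MAJ}\,\pi=\sum_{i\in D(\pi)} i, \] \[ Id(\pi)=\{\pi_i:\ \text{there is } j<i \text{ with } \pi_j=\pi_i+1\},\qquad \mathrm{F}\,\pi=\pi_1 , \] and let \[ \mathrm{STAT}\,\pi=(\underline{21}+\underline{13}2+\underline{21}3+\underline{32}1)\,\pi , \] where a vincular pattern $\tau$ denotes the function that counts its occurrences, i.e. the subsequences of $\pi$ that are order-isomorphic to $\tau$ and in which the letters corresponding to the underlined letters of $\tau$ are adjacent in $\pi$. **Theorem.** For every $n$, the statistics $(\mathrm{des}, Id, \mathrm{F}, \mathrm{MAJ}, \mathrm{STAT})$ and $(\mathrm{des}, Id, \mathrm{F}, \mathrm{STAT}, \mathrm{MAJ})$ have the same joint distribution on $\mathcal{S}_n$. That is, for all $d,f,a,b\in\mathbb{N}$ and every finite set $S\subset\mathbb{N}$, the number of $\pi\in\mathcal{S}_n$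 with \[ \mathrm{des}\,\pi=d,\quad Id(\pi)=S,\quad \mathrm{F}\,\pi=f,\quad \mathrm{MAJ}\,\pi=a,\quad \mathrm{STAT}\,\pi=b \] equals the number of $\pi\in\mathcal{S}_n$ with \[ \mathrm{des}\,\pi=d,\quad Id(\pi)=S,\quad \mathrm{F}\,\pi=f,\quad \mathrm{STAT}\,\pi=a,\quad \mathrm{MAJ}\,\pi=b . \] (For $n=0$, where there is no first letter, put $\mathrm{F}\,\pi=0$.) -/

import Mathlib

/-! Statistics on the symmetric group. A permutation `π : Equiv.Perm (Fin n)` is read as the word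
`π_1 π_2 ⋯ π_n` in the letters `1, …, n`. The element `i : Fin n` stands for the position `i + 1`,
respectively for the letter `i + 1`; all set-valued and numerical statistics below use the usual
numbering from `1`. -/

namespace PermStat

/-- The letter `π_{i+1}`, as an element of `{1, …, n}`. -/
def letter {n : ℕ} (π : Equiv.Perm (Fin n)) (i : Fin n) : ℕ := (π i : ℕ) + 1

/-- The descent set `D(π) = {i : 1 ≤ i < n, π_i > π_{i+1}}`. -/
def descentSet {n : ℕ} (π : Equiv.Perm (Fin n)) : Finset ℕ :=
  (Finset.univ.filter fun i : Fin n =>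
    ∃ j : Fin n, (j : ℕ) = (i : ℕ) + 1 ∧ letter π j < letter π i).image fun i : Fin n => (i : ℕ) + 1

/-- The inverse descent set `Id(π) = {π_i : there is j < i with π_j = π_i + 1}`. -/
def inverseDescentSet {n : ℕ} (π : Equiv.Perm (Fin n)) : Finset ℕ :=
  (Finset.univ.filter fun i : Fin n =>
    ∃ j : Fin n, j < i ∧ letter π j = letter π i + 1).image fun i : Fin n => letter π i

/-- The number of descents. -/
def des {n : ℕ} (π : Equiv.Perm (Fin n)) : ℕ := (descentSet π).card

/-- The first letter `π_1`. For `n = 0` there is no first letter, and the value is `0`. -/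
def firstLetter {n : ℕ} (π : Equiv.Perm (Fin n)) : ℕ :=
  if h : 0 < n then letter π ⟨0, h⟩ else 0

/-- The major index, the sum of all descents. -/
def MAJ {n : ℕ} (π : Equiv.Perm (Fin n)) : ℕ := ∑ j ∈ descentSet π, j

/-- The positions `e 0 < e 1 < ⋯` carry an occurrence in `π` of the vincular pattern with letters
`p 0, p 1, …`, where the letters number `i` and `i + 1` are underlined together for `i ∈ A`: the
letters of `π` at these positions have the same pairwise comparisons as the letters of `p`, and
letters that are underlined together stand at adjacent positions. -/
def IsOccurrence {n k : ℕ} (p : Fin k → ℕ) (A : Finset (Fin k)) (π : Equiv.Perm (Fin n))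
    (e : Fin k → Fin n) : Prop :=
  (∀ i j : Fin k, i < j → e i < e j) ∧
  (∀ i j : Fin k, letter π (e i) < letter π (e j) ↔ p i < p j) ∧
  (∀ i ∈ A, ∀ j : Fin k, (j : ℕ) = (i : ℕ) + 1 → (e j : ℕ) = (e i : ℕ) + 1)

instance {n k : ℕ} (p : Fin k → ℕ) (A : Finset (Fin k)) (π : Equiv.Perm (Fin n))
    (e : Fin k → Fin n) : Decidable (IsOccurrence p A π e) := by
  unfold IsOccurrence; infer_instance

/-- The number of occurrences of a vincular pattern in `π`. -/
def occurrences {n k : ℕ} (p : Fin k → ℕ) (A : Finset (Fin k)) (π : Equiv.Perm (Fin n)) : ℕ :=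
  (Finset.univ.filter fun e : Fin k → Fin n => IsOccurrence p A π e).card

/-- The statistic STAT: the number of occurrences of the vincular patterns `21`, `132`, `213`,
`321`, in each of which the first two letters are underlined, that is, have to be adjacent. -/
def STAT {n : ℕ} (π : Equiv.Perm (Fin n)) : ℕ :=
  occurrences ![2, 1] {0} π + occurrences ![1, 3, 2] {0} π +
    occurrences ![2, 1, 3] {0} π + occurrences ![3, 2, 1] {0} π

end PermStat

/-! The proof rests on the identity STAT + MAJ + (F − 1) = (n + 1) des for n ≥ 1 (`STAT_add_MAJ`).
It therefore suffices to find a bijection that preserves des, Id and F, and under which the two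
values of MAJ add up to (n + 1) des − (F − 1).

Colour each letter by its comparison with the first letter. If the colour word after the first
letter is reversed, and the descents between neighbours of equal colour are reversed along with it,
then des is preserved and MAJ changes as required (`des_and_MAJ_reversal`): a descent between
different colours is determined by the colours alone.

Such a bijection that also preserves Id exists by counting. Fix the colours and the first letter,
and prescribe supersets of the inner descent set and of Id. The permutations obtained are increasing
on certain blocks of positions, with inverses increasing on certain blocks of values. They are the
sorted representatives of double cosets of two Young subgroups, so their number does not change when
the position blocks are rearranged (`card_isBisorted_comp`). Inclusion-exclusion passes from
supersets to the sets themselves (`card_innerDescents_eq`). -/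

namespace PermStat

/-! ### Sorted representatives of double cosets of Young subgroups -/

/-- Two functions that are weakly increasing on the fibers of `a` and differ by a permutation
preserving these fibers are equal. -/
theorem eq_of_monotone_on_fibers {n : ℕ} {α β : Type*} [LinearOrder β] (a : Fin n → α)
    (f f' : Fin n → β) (g : Equiv.Perm (Fin n))
    (hf : ∀ i j, i < j → a i = a j → f i ≤ f j) (hf' : ∀ i j, i < j → a i = a j → f' i ≤ f' j)
    (ha : ∀ i, a (g i) = a i) (hff : ∀ i, f' i = f (g i)) : f = f' := by
  classical
  have key : ∀ (f f' : Fin n → β) (g : Equiv.Perm (Fin n)),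
      (∀ i j, i < j → a i = a j → f i ≤ f j) → (∀ i j, i < j → a i = a j → f' i ≤ f' j) →
      (∀ i, a (g i) = a i) → (∀ i, f' i = f (g i)) → ∀ i, f' i ≤ f i := by
    intro f f' g hf hf' ha hff i
    by_contra! hlt
    have hcard : (Finset.univ.filter fun j => a j = a i ∧ f' j ≤ f i).card =
        (Finset.univ.filter fun j => a j = a i ∧ f j ≤ f i).card := by
      refine Finset.card_bij (fun j _ => g j) ?_ (fun _ _ _ _ h => g.injective h) ?_
      · intro j hj
        simpa [ha, ← hff] using hj
      · intro j hj
        refine ⟨g.symm j, ?_, by simp⟩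
        have h1 := ha (g.symm j)
        have h2 := hff (g.symm j)
        simp only [Equiv.apply_symm_apply] at h1 h2
        simpa [← h1, h2] using hj
    -- Since `f i < f' i`, monotonicity of `f'` forces `j < i` on the left, and then `f j ≤ f i`;
    -- the index `i` itself lies only on the right.
    have hss : (Finset.univ.filter fun j => a j = a i ∧ f' j ≤ f i) ⊂
        (Finset.univ.filter fun j => a j = a i ∧ f j ≤ f i) := by
      rw [Finset.ssubset_iff_of_subset]
      · exact ⟨i, by simp, by simp [hlt]⟩
      · intro j hj
        simp only [Finset.mem_filter, Finset.mem_univ, true_and] at hj ⊢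
        refine ⟨hj.1, ?_⟩
        rcases lt_trichotomy i j with h | h | h
        · exact absurd ((hf' i j h hj.1.symm).trans hj.2) (not_le.2 hlt)
        · subst h; exact le_rfl
        · exact hf j i h hj.1
    exact (Finset.card_lt_card hss).ne hcard
  funext i
  refine le_antisymm (key f' f g.symm hf' hf (fun i => ?_) (fun i => ?_) i)
    (key f f' g hf hf' ha hff i)
  · simpa using (ha (g.symm i)).symm
  · simp [hff]

/-- The sum `∑ i * π i`, which measures how far `π` is sorted. -/
def sortedness {n : ℕ} (π : Equiv.Perm (Fin n)) : ℤ := ∑ i : Fin n, (i : ℤ) * (π i : ℤ)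

theorem sortedness_symm {n : ℕ} (π : Equiv.Perm (Fin n)) :
    sortedness π.symm = sortedness π := by
  unfold sortedness
  rw [← Equiv.sum_comp π]
  exact Finset.sum_congr rfl fun i _ => by simp [mul_comm]

/-- The gain is `(j - i) * (π i - π j)`. -/
theorem sortedness_lt_mul_swap {n : ℕ} (π : Equiv.Perm (Fin n)) {i j : Fin n} (hij : i < j)
    (h : π j < π i) : sortedness π < sortedness (π * Equiv.swap i j) := by
  rw [← sub_pos]
  unfold sortedness
  rw [← Finset.sum_sub_distrib, Fintype.sum_eq_add i j hij.ne]
  · simp only [Equiv.Perm.mul_apply, Equiv.swap_apply_left, Equiv.swap_apply_right]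
    have h1 : (i : ℤ) < j := by exact_mod_cast hij
    have h2 : ((π j : ℕ) : ℤ) < (π i : ℕ) := by exact_mod_cast h
    nlinarith
  · rintro x ⟨hx, hx'⟩
    simp [Equiv.swap_apply_of_ne_of_ne hx hx']

/-- `π` is increasing on the fibers of `a` and its inverse is increasing on the fibers of `b`. -/
def IsBisorted {n : ℕ} {α β : Type*} (a : Fin n → α) (b : Fin n → β)
    (π : Equiv.Perm (Fin n)) : Prop :=
  (∀ i j, i < j → a i = a j → π i < π j) ∧
    ∀ u v, u < v → b u = b v → π.symm u < π.symm v

theorem apply_swap_eq {n : ℕ} {γ : Type*} (c : Fin n → γ) {i j : Fin n} (hc : c i = c j)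
    (x : Fin n) : c (Equiv.swap i j x) = c x := by
  rcases eq_or_ne x i with rfl | hi
  · simp [hc]
  rcases eq_or_ne x j with rfl | hj
  · simp [hc]
  rw [Equiv.swap_apply_of_ne_of_ne hi hj]

/-- An element of the double coset with maximal `sortedness` works: an inversion inside a block of
positions or of values could be undone by a swap within that block. -/
theorem exists_isBisorted {n : ℕ} {α β : Type*} (a : Fin n → α) (b : Fin n → β)
    (π : Equiv.Perm (Fin n)) : ∃ g h : Equiv.Perm (Fin n), (∀ i, a (g i) = a i) ∧
      (∀ v, b (h v) = b v) ∧ IsBisorted a b (h * π * g) := by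
  classical
  obtain ⟨p, hp, hmax⟩ := Finset.exists_max_image
    (Finset.univ.filter fun p : Equiv.Perm (Fin n) × Equiv.Perm (Fin n) =>
      (∀ i, a (p.1 i) = a i) ∧ ∀ v, b (p.2 v) = b v)
    (fun p => sortedness (p.2 * π * p.1)) ⟨(1, 1), by simp⟩
  simp only [Finset.mem_filter, Finset.mem_univ, true_and] at hp hmax
  refine ⟨p.1, p.2, hp.1, hp.2, fun i j hij hs => ?_, fun u v huv hs => ?_⟩
  · by_contra hlt
    have hne : (p.2 * π * p.1) j ≠ (p.2 * π * p.1) i := fun h => hij.ne' (Equiv.injective _ h)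
    have h1 := sortedness_lt_mul_swap (p.2 * π * p.1) hij (lt_of_le_of_ne (not_lt.1 hlt) hne)
    have h2 := hmax (p.1 * Equiv.swap i j, p.2)
      ⟨fun x => by simp [hp.1, apply_swap_eq a hs], hp.2⟩
    simp only [← mul_assoc] at h2
    exact absurd h1 (not_lt.2 h2)
  · by_contra hlt
    have hne : (p.2 * π * p.1).symm v ≠ (p.2 * π * p.1).symm u :=
      fun h => huv.ne' (Equiv.injective _ h)
    have h1 := sortedness_lt_mul_swap (p.2 * π * p.1).symm huv
      (lt_of_le_of_ne (not_lt.1 hlt) hne)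
    have h2 := hmax (p.1, Equiv.swap u v * p.2)
      ⟨hp.1, fun x => by simp [hp.2, apply_swap_eq b hs]⟩
    rw [← sortedness_symm (Equiv.swap u v * p.2 * π * p.1), ← sortedness_symm (p.2 * π * p.1)] at h2
    have h3 : (Equiv.swap u v * p.2 * π * p.1).symm =
        (p.2 * π * p.1).symm * Equiv.swap u v := by
      ext x; simp [Equiv.Perm.mul_def]
    rw [h3] at h2
    exact absurd h1 (not_lt.2 h2)

/-- Uniqueness of the representative: sorting on the blocks of `a` determines `b ∘ π`, and then
sorting on the blocks of `b` determines the inverse. -/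
theorem IsBisorted.eq {n : ℕ} {α β : Type*} [LinearOrder β] {a : Fin n → α} {b : Fin n → β}
    (hb : Monotone b) {π τ g h : Equiv.Perm (Fin n)} (hπ : IsBisorted a b π)
    (hτ : IsBisorted a b τ) (hg : ∀ i, a (g i) = a i) (hh : ∀ v, b (h v) = b v)
    (e : τ = h * π * g) : τ = π := by
  have h1 : b ∘ π = b ∘ τ := eq_of_monotone_on_fibers a _ _ g
    (fun i j hij hs => hb (hπ.1 i j hij hs).le) (fun i j hij hs => hb (hτ.1 i j hij hs).le) hg
    (fun i => by simp [e, hh])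
  have h2 : (π.symm : Fin n → Fin n) = τ.symm :=
    eq_of_monotone_on_fibers b _ _ (π * τ.symm)
    (fun i j hij hs => (hπ.2 i j hij hs).le) (fun i j hij hs => (hτ.2 i j hij hs).le)
    (fun v => by simpa using congrFun h1 (τ.symm v)) (fun v => by simp)
  have h3 : π.symm = τ.symm := Equiv.coe_fn_injective h2
  simpa using congrArg Equiv.symm h3.symm

-- Right multiplication by `r` carries double cosets for `a` to double cosets for `a ∘ r`; passing
-- to the sorted representative is then injective. Colours survive because they are constant on
-- blocks.
open Classical in
theorem card_isBisorted_le {n : ℕ} {α β γ : Type*} [LinearOrder β] (a : Fin n → α)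
    (b : Fin n → β) (hb : Monotone b) (c col : Fin n → γ) (hc : ∀ i j, a i = a j → c i = c j)
    (hcol : ∀ u v, b u = b v → col u = col v) (r : Equiv.Perm (Fin n)) :
    (Finset.univ.filter fun π => IsBisorted a b π ∧ ∀ i, col (π i) = c i).card ≤
      (Finset.univ.filter fun π => IsBisorted (a ∘ r) b π ∧ ∀ i, col (π i) = c (r i)).card := by
  choose g h hg hh hs using fun π => exists_isBisorted (a ∘ r) b (π * r)
  refine Finset.card_le_card_of_injOn (fun π => h π * (π * r) * g π) ?_ ?_
  · intro π hπ
    simp only [Finset.coe_filter, Finset.mem_univ, true_and, Set.mem_ofPred_eq] at hπ ⊢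
    refine ⟨hs π, fun i => ?_⟩
    rw [hc _ _ (hg π i).symm, ← hπ.2 (r (g π i))]
    exact hcol _ _ (hh π _)
  · intro π hπ τ hτ e
    simp only [Finset.coe_filter, Finset.mem_univ, true_and, Set.mem_ofPred_eq] at hπ hτ e
    -- Conjugation by `r` turns permutations preserving `a ∘ r` into permutations preserving `a`.
    refine (hπ.1.eq hb hτ.1 (g := r * g π * (g τ)⁻¹ * r⁻¹) (h := (h τ)⁻¹ * h π) ?_ ?_ ?_).symm
    · intro i
      have h1 := hg π ((g τ).symm (r.symm i))
      have h2 := hg τ ((g τ).symm (r.symm i))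
      simp only [Function.comp_apply, Equiv.apply_symm_apply] at h1 h2
      simpa using h1.trans h2.symm
    · intro v
      have h2 := hh τ ((h τ).symm (h π v))
      rw [Equiv.apply_symm_apply, hh] at h2
      simpa using h2.symm
    · calc τ = (h τ)⁻¹ * (h τ * (τ * r) * g τ) * (g τ)⁻¹ * r⁻¹ := by group
        _ = _ := by rw [← e]; group

open Classical in
theorem card_isBisorted_comp {n : ℕ} {α β γ : Type*} [LinearOrder β] (a : Fin n → α)
    (b : Fin n → β) (hb : Monotone b) (c col : Fin n → γ) (hc : ∀ i j, a i = a j → c i = c j)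
    (hcol : ∀ u v, b u = b v → col u = col v) (r : Equiv.Perm (Fin n)) :
    (Finset.univ.filter fun π => IsBisorted a b π ∧ ∀ i, col (π i) = c i).card =
      (Finset.univ.filter fun π => IsBisorted (a ∘ r) b π ∧ ∀ i, col (π i) = c (r i)).card := by
  refine le_antisymm (card_isBisorted_le a b hb c col hc hcol r) ?_
  have := card_isBisorted_le (a ∘ r) b hb (c ∘ r) col (fun i j h => hc _ _ h) hcol r⁻¹
  simpa [Function.comp_def] using this

/-! ### Blocks of positions and of values cut out by descent sets -/

section
open scoped Fin.NatCast

/-- Read `p l` as a cut between `l` and `l + 1`. Then `Nat.count p` numbers the blocks, and a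
transitive relation needs checking only between neighbours in a block. -/
theorem forall_count_eq_iff (p : ℕ → Prop) [DecidablePred p] (R : ℕ → ℕ → Prop)
    (hR : ∀ i j k, R i j → R j k → R i k) (N : ℕ) :
    (∀ i j, i < j → j ≤ N → Nat.count p i = Nat.count p j → R i j) ↔
      ∀ l < N, ¬ p l → R l (l + 1) := by
  constructor
  · intro h l hl hp
    exact h l (l + 1) (Nat.lt_succ_self l) hl (by simp [Nat.count_succ, hp])
  · intro h i j hij
    induction j, (Nat.succ_le_of_lt hij) using Nat.le_induction with
    | base =>
      intro hj hc
      refine h i hj fun hp => ?_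
      simp [Nat.count_succ, hp] at hc
    | succ j hj ih =>
      intro hjN hc
      have h1 : Nat.count p i ≤ Nat.count p j := Nat.count_monotone p (by omega)
      have h2 : Nat.count p (j + 1) = Nat.count p j + if p j then 1 else 0 := Nat.count_succ p j
      have hp : ¬ p j := fun hp => by simp [hp] at h2; omega
      simp only [hp, if_false] at h2
      exact hR _ _ _ (ih (by omega) (by omega) (by omega)) (h j (by omega) hp)

theorem natCast_lt_natCast {N i j : ℕ} (hj : j ≤ N) (hij : i < j) :
    (i : Fin (N + 1)) < (j : Fin (N + 1)) := by
  rw [Fin.lt_def, Fin.val_natCast, Fin.val_natCast, Nat.mod_eq_of_lt (by omega),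
    Nat.mod_eq_of_lt (by omega)]
  exact hij

theorem val_natCast_of_le {N i : ℕ} (hi : i ≤ N) : ((i : Fin (N + 1)) : ℕ) = i := by
  rw [Fin.val_natCast, Nat.mod_eq_of_lt (by omega)]

theorem val_neg_of_ne_zero {N : ℕ} {i : Fin (N + 1)} (hi : i ≠ 0) :
    ((-i : Fin (N + 1)) : ℕ) = N + 1 - i := by
  have : (i : ℕ) ≠ 0 := fun h => hi (Fin.ext h)
  rw [Fin.val_neg', Nat.mod_eq_of_lt (by omega)]

theorem neg_natCast_lt_neg_natCast {N i j : ℕ} (hi : 0 < i) (hj : j ≤ N) (hij : i < j) :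
    -(j : Fin (N + 1)) < -(i : Fin (N + 1)) := by
  have h1 : (i : Fin (N + 1)) ≠ 0 := fun h => by
    have := congrArg Fin.val h
    rw [val_natCast_of_le (by omega)] at this
    simp at this; omega
  have h2 : (j : Fin (N + 1)) ≠ 0 := fun h => by
    have := congrArg Fin.val h
    rw [val_natCast_of_le (by omega)] at this
    simp at this; omega
  rw [Fin.lt_def, val_neg_of_ne_zero h1, val_neg_of_ne_zero h2, val_natCast_of_le hj,
    val_natCast_of_le (by omega)]
  omega

/-- The word of comparisons of the letters of `π` with its first letter. -/
def colorWord {N : ℕ} (π : Equiv.Perm (Fin (N + 1))) (i : Fin (N + 1)) : Ordering :=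
  cmp (π i) (π 0)

/-- The descents between adjacent letters that compare in the same way with the first letter. -/
def innerDescents {N : ℕ} (π : Equiv.Perm (Fin (N + 1))) : Finset ℕ :=
  (Finset.range N).filter fun j => j ≠ 0 ∧ colorWord π (j : ℕ) = colorWord π (j + 1 : ℕ) ∧
    π (j + 1 : ℕ) < π (j : ℕ)

/-- The descents between adjacent letters that compare in the same way with the first letter,
with the positions after the first one numbered from the end of the word. -/
def reversedInnerDescents {N : ℕ} (π : Equiv.Perm (Fin (N + 1))) : Finset ℕ :=
  (Finset.range N).filter fun j => j ≠ 0 ∧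
    colorWord π (-(j : ℕ)) = colorWord π (-(j + 1 : ℕ)) ∧ π (-(j : ℕ)) < π (-(j + 1 : ℕ))

theorem mem_inverseDescentSet {N : ℕ} (π : Equiv.Perm (Fin (N + 1))) (x : ℕ) :
    x ∈ inverseDescentSet π ↔
      ∃ u < N, x = u + 1 ∧ π.symm (u + 1 : ℕ) < π.symm (u : ℕ) := by
  simp only [inverseDescentSet, Finset.mem_image, Finset.mem_filter, Finset.mem_univ, true_and]
  simp only [letter]
  constructor
  · rintro ⟨i, ⟨j, hji, h⟩, rfl⟩
    have hlt := (π j).isLt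
    refine ⟨π i, by omega, rfl, ?_⟩
    have h1 : (((π i : ℕ) + 1 : ℕ) : Fin (N + 1)) = π j := by
      apply Fin.ext; rw [val_natCast_of_le (by omega)]; omega
    rw [h1, Fin.cast_val_eq_self]
    simpa using hji
  · rintro ⟨u, hu, rfl, h⟩
    refine ⟨π.symm (u : ℕ), ⟨π.symm (u + 1 : ℕ), h, ?_⟩, ?_⟩
    · rw [Equiv.apply_symm_apply, Equiv.apply_symm_apply, val_natCast_of_le hu,
        val_natCast_of_le hu.le]
    · rw [Equiv.apply_symm_apply, val_natCast_of_le hu.le]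

/-- Replaces comparison with `π 0` by a colouring of values that does not depend on `π`, as the
double coset count requires. -/
theorem colorWord_eq_iff {N : ℕ} (π : Equiv.Perm (Fin (N + 1))) (k : Fin (N + 1))
    (c : Fin (N + 1) → Ordering) (hc : c 0 = .eq) :
    (colorWord π = c ∧ π 0 = k) ↔ ∀ i, cmp (π i) k = c i := by
  constructor
  · rintro ⟨rfl, rfl⟩ i; rfl
  · intro h
    have h0 : π 0 = k := by simpa [hc] using h 0
    exact ⟨funext fun i => by rw [← h i, colorWord, h0], h0⟩

theorem innerDescents_subset_iff {N : ℕ} (π : Equiv.Perm (Fin (N + 1))) (E : Finset ℕ) :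
    innerDescents π ⊆ E ↔ ∀ l < N, ¬ (l = 0 ∨ colorWord π (l : ℕ) ≠ colorWord π (l + 1 : ℕ) ∨
      l ∈ E) → π (l : ℕ) < π (l + 1 : ℕ) := by
  constructor
  · intro h l hl hn
    push Not at hn
    by_contra hlt
    refine hn.2.2 (h ?_)
    simp only [innerDescents, Finset.mem_filter, Finset.mem_range]
    refine ⟨hl, hn.1, hn.2.1, lt_of_le_of_ne (not_lt.1 hlt) fun e => ?_⟩
    exact (natCast_lt_natCast hl (Nat.lt_succ_self l)).ne' (π.injective e)
  · intro h l hl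
    simp only [innerDescents, Finset.mem_filter, Finset.mem_range] at hl
    by_contra hE
    exact absurd (h l hl.1 (by tauto)) (not_lt.2 hl.2.2.2.le)

theorem reversedInnerDescents_subset_iff {N : ℕ} (π : Equiv.Perm (Fin (N + 1)))
    (E : Finset ℕ) :
    reversedInnerDescents π ⊆ E ↔ ∀ l < N, ¬ (l = 0 ∨
      colorWord π (-(l : ℕ)) ≠ colorWord π (-(l + 1 : ℕ)) ∨ l ∈ E) →
        π (-(l + 1 : ℕ)) < π (-(l : ℕ)) := by
  constructor
  · intro h l hl hn
    push Not at hn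
    by_contra hlt
    refine hn.2.2 (h ?_)
    simp only [reversedInnerDescents, Finset.mem_filter, Finset.mem_range]
    refine ⟨hl, hn.1, hn.2.1, lt_of_le_of_ne (not_lt.1 hlt) fun e => ?_⟩
    exact (natCast_lt_natCast hl (Nat.lt_succ_self l)).ne (neg_injective (π.injective e))
  · intro h l hl
    simp only [reversedInnerDescents, Finset.mem_filter, Finset.mem_range] at hl
    by_contra hE
    exact absurd (h l hl.1 (by tauto)) (not_lt.2 hl.2.2.2.le)

/-- The value `π 0` precedes both of its neighbours, so their relative order to it is forced. Hence
it can be cut off as a block of its own, which makes the colour constant on value blocks. -/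
theorem inverseDescentSet_subset_iff {N : ℕ} (π : Equiv.Perm (Fin (N + 1))) (B : Finset ℕ) :
    inverseDescentSet π ⊆ B ↔ (π 0 ≠ 0 → (π 0 : ℕ) ∈ B) ∧
      ∀ u < N, ¬ (u + 1 ∈ B ∨ u + 1 = π 0 ∨ u = π 0) →
        π.symm (u : ℕ) < π.symm (u + 1 : ℕ) := by
  constructor
  · intro h
    constructor
    · intro h0
      have h0' : (π 0 : ℕ) ≠ 0 := fun e => h0 (Fin.ext e)
      refine h ((mem_inverseDescentSet π _).2 ⟨π 0 - 1, by omega, by omega, ?_⟩)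
      rw [Nat.sub_add_cancel (by omega), Fin.cast_val_eq_self, Equiv.symm_apply_apply]
      refine Fin.pos_iff_ne_zero.2 fun e => ?_
      have := congrArg (fun x => (π x : ℕ)) e
      simp only [Equiv.apply_symm_apply] at this
      rw [val_natCast_of_le (by omega)] at this
      omega
    · intro u hu hn
      by_contra hlt
      refine hn (Or.inl (h ((mem_inverseDescentSet π _).2
        ⟨u, hu, rfl, lt_of_le_of_ne (not_lt.1 hlt) fun e => ?_⟩)))
      exact (natCast_lt_natCast hu (Nat.lt_succ_self u)).ne' (π.symm.injective e)
  · rintro ⟨h0, h⟩ x hx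
    obtain ⟨u, hu, rfl, hlt⟩ := (mem_inverseDescentSet π _).1 hx
    by_contra hB
    by_cases h1 : u + 1 = π 0
    · exact hB (h1 ▸ h0 fun e => by rw [e] at h1; simp at h1)
    by_cases h2 : u = π 0
    · rw [h2, Fin.cast_val_eq_self, Equiv.symm_apply_apply] at hlt
      simp at hlt
    exact absurd (h u hu (by tauto)) (not_lt.2 hlt.le)

theorem forall_lt_count_iff {N : ℕ} (p : ℕ → Prop) [DecidablePred p] {α : Type*} [Preorder α]
    (f : Fin (N + 1) → α) :
    (∀ i j : Fin (N + 1), i < j → Nat.count p i = Nat.count p j → f i < f j) ↔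
      ∀ l < N, ¬ p l → f (l : ℕ) < f (l + 1 : ℕ) := by
  rw [← forall_count_eq_iff p (fun i j => f (i : ℕ) < f (j : ℕ)) (fun _ _ _ => lt_trans)]
  constructor
  · intro h i j hij hj hc
    refine h _ _ (natCast_lt_natCast hj hij) ?_
    rwa [val_natCast_of_le hj, val_natCast_of_le (by omega)]
  · intro h i j hij hc
    simpa using h i j hij (by omega) hc

/-- Negation on `Fin (N + 1)` fixes `0` and reverses the order of the rest; the cut `p 0` keeps `0`
out of every other block. -/
theorem forall_lt_count_neg_iff {N : ℕ} (p : ℕ → Prop) [DecidablePred p] (hp : p 0)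
    {α : Type*} [Preorder α] (f : Fin (N + 1) → α) :
    (∀ i j : Fin (N + 1), i < j → Nat.count p (-i : Fin (N + 1)) =
        Nat.count p (-j : Fin (N + 1)) → f i < f j) ↔
      ∀ l < N, ¬ p l → f (-(l + 1 : ℕ)) < f (-(l : ℕ)) := by
  have count_pos : ∀ j : ℕ, j ≠ 0 → Nat.count p j ≠ 0 := fun j hj h => by
    have := Nat.count_monotone p (Nat.one_le_iff_ne_zero.2 hj)
    simp [Nat.count_succ, hp, h] at this
  rw [← forall_count_eq_iff p (fun i j => f (-(j : ℕ)) < f (-(i : ℕ)))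
    (fun _ _ _ h h' => lt_trans h' h)]
  constructor
  · intro h i j hij hj hc
    have hi : 0 < i := by
      rcases Nat.eq_zero_or_pos i with rfl | h
      · exact absurd hc.symm (by simpa using count_pos j (by omega))
      · exact h
    refine h _ _ (neg_natCast_lt_neg_natCast hi hj hij) ?_
    rw [neg_neg, neg_neg, val_natCast_of_le hj, val_natCast_of_le (by omega)]
    exact hc.symm
  · intro h i j hij hc
    have hj : j ≠ 0 := fun e => by simp [e] at hij
    have hi : i ≠ 0 := by
      rintro rfl
      rw [val_neg_of_ne_zero hj] at hc
      simp only [neg_zero, Fin.val_zero, Nat.count_zero] at hc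
      exact absurd hc.symm (count_pos _ (by omega))
    have h1 := h (-j : Fin (N + 1)) (-i : Fin (N + 1)) ?_ (by omega) hc.symm
    · simpa using h1
    · rw [val_neg_of_ne_zero hi, val_neg_of_ne_zero hj]
      have : (i : ℕ) < j := hij
      omega

theorem eq_of_count_eq {γ : Type*} (p : ℕ → Prop) [DecidablePred p] (c : ℕ → γ) (N : ℕ)
    (h : ∀ l < N, ¬ p l → c l = c (l + 1)) (i j : ℕ) (hi : i ≤ N) (hj : j ≤ N)
    (hc : Nat.count p i = Nat.count p j) : c i = c j := by
  have key := (forall_count_eq_iff p (fun i j => c i = c j)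
    (fun _ _ _ => Eq.trans) N).2 h
  rcases lt_trichotomy i j with hij | rfl | hij
  · exact key i j hij hj hc
  · rfl
  · exact (key j i hij hi hc.symm).symm

theorem card_innerDescents_subset {N : ℕ} (k : Fin (N + 1)) (c : Fin (N + 1) → Ordering)
    (E B : Finset ℕ) :
    (Finset.univ.filter fun π : Equiv.Perm (Fin (N + 1)) =>
      (colorWord π = c ∧ π 0 = k) ∧ innerDescents π ⊆ E ∧ inverseDescentSet π ⊆ B).card =
    (Finset.univ.filter fun π : Equiv.Perm (Fin (N + 1)) =>
      ((fun i => colorWord π (-i)) = c ∧ π 0 = k) ∧ reversedInnerDescents π ⊆ E ∧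
        inverseDescentSet π ⊆ B).card := by
  classical
  by_cases hc : c 0 = .eq
  swap
  · rw [Finset.filter_false_of_mem, Finset.filter_false_of_mem]
    · rintro π - ⟨⟨rfl, -⟩, -⟩
      simp [colorWord] at hc
    · rintro π - ⟨⟨rfl, -⟩, -⟩
      simp [colorWord] at hc
  by_cases hB : k ≠ 0 → (k : ℕ) ∈ B
  swap
  · rw [Finset.filter_false_of_mem, Finset.filter_false_of_mem]
    · rintro π - ⟨⟨-, rfl⟩, -, h⟩
      exact hB ((inverseDescentSet_subset_iff π B).1 h).1
    · rintro π - ⟨⟨-, rfl⟩, -, h⟩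
      exact hB ((inverseDescentSet_subset_iff π B).1 h).1
  -- Cut after the first position, at colour changes and at the allowed descents; among values, cut
  -- at `B` and on both sides of `k`.
  set p : ℕ → Prop := fun l => l = 0 ∨ c (l : ℕ) ≠ c (l + 1 : ℕ) ∨ l ∈ E with hp
  set q : ℕ → Prop := fun u => u + 1 ∈ B ∨ u + 1 = k ∨ u = k with hq
  have key := card_isBisorted_comp (fun i : Fin (N + 1) => Nat.count p i)
    (fun v : Fin (N + 1) => Nat.count q v) (fun u v h => Nat.count_monotone q h) c
    (fun v => cmp v k) ?_ ?_ (Equiv.neg (Fin (N + 1)))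
  · convert key using 2
    · ext π
      simp only [Finset.mem_filter, Finset.mem_univ, true_and]
      rw [and_comm, colorWord_eq_iff π k c hc]
      refine and_congr_left fun h => ?_
      obtain ⟨rfl, rfl⟩ := (colorWord_eq_iff π k c hc).2 h
      rw [innerDescents_subset_iff, inverseDescentSet_subset_iff, and_iff_right hB, IsBisorted,
        forall_lt_count_iff p, forall_lt_count_iff q]
    · ext π
      simp only [Finset.mem_filter, Finset.mem_univ, true_and]
      have e : ((fun i => colorWord π (-i)) = c ∧ π 0 = k) ↔
          ∀ i, cmp (π i) k = c (-i) := by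
        rw [← colorWord_eq_iff π k (fun i => c (-i)) (by simpa using hc)]
        refine and_congr_left fun _ => ⟨?_, ?_⟩
        · rintro rfl; simp
        · intro h; simp [h]
      rw [and_comm, e]
      refine and_congr_left fun h => ?_
      obtain ⟨rfl, rfl⟩ := e.2 h
      rw [reversedInnerDescents_subset_iff, inverseDescentSet_subset_iff, and_iff_right hB,
        IsBisorted, forall_lt_count_iff q]
      exact and_congr_left fun _ => (forall_lt_count_neg_iff p (Or.inl rfl) π).symm
  · intro i j h
    simpa using eq_of_count_eq p (fun l => c (l : ℕ)) N
      (fun l _ hl => by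
        by_contra hne
        exact hl (Or.inr (Or.inl hne))) i j (by omega) (by omega) h
  · intro u v h
    have := eq_of_count_eq q (fun l => cmp l (k : ℕ)) N
      (fun l _ hl => by
        simp only [hq, not_or] at hl
        rcases lt_or_gt_of_ne hl.2.2 with h1 | h1
        · rw [(cmp_eq_lt_iff _ _).2 h1, (cmp_eq_lt_iff _ _).2 (by omega)]
        · rw [(cmp_eq_gt_iff _ _).2 h1, (cmp_eq_gt_iff _ _).2 (by omega)]) u v
      (by omega) (by omega) h
    exact this

/-! ### Inclusion-exclusion and the reversing bijection -/

theorem eq_of_sum_Iic_eq {ι : Type*} [PartialOrder ι] [LocallyFiniteOrderBot ι]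
    [WellFoundedLT ι] {f g : ι → ℕ}
    (h : ∀ x, ∑ y ∈ Finset.Iic x, f y = ∑ y ∈ Finset.Iic x, g y) : f = g := by
  classical
  funext x
  induction x using WellFoundedLT.induction with
  | ind x ih =>
    have hx := h x
    rw [← Finset.Iio_insert, Finset.sum_insert (by simp), Finset.sum_insert (by simp),
      Finset.sum_congr rfl fun y hy => ih y (Finset.mem_Iio.1 hy)] at hx
    exact Nat.add_right_cancel hx

theorem card_innerDescents_eq {N : ℕ} (k : Fin (N + 1)) (c : Fin (N + 1) → Ordering)
    (x : Finset ℕ × Finset ℕ) :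
    (Finset.univ.filter fun π : Equiv.Perm (Fin (N + 1)) =>
      (colorWord π = c ∧ π 0 = k) ∧ (innerDescents π, inverseDescentSet π) = x).card =
    (Finset.univ.filter fun π : Equiv.Perm (Fin (N + 1)) =>
      ((fun i => colorWord π (-i)) = c ∧ π 0 = k) ∧
        (reversedInnerDescents π, inverseDescentSet π) = x).card := by
  classical
  have sum_Iic : ∀ (P : Equiv.Perm (Fin (N + 1)) → Prop)
      (s : Equiv.Perm (Fin (N + 1)) → Finset ℕ × Finset ℕ) (x : Finset ℕ × Finset ℕ),
      ∑ y ∈ Finset.Iic x, (Finset.univ.filter fun π => P π ∧ s π = y).card =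
        (Finset.univ.filter fun π => P π ∧ s π ≤ x).card := by
    intro P s x
    rw [Finset.card_eq_sum_card_fiberwise (f := s) (t := Finset.Iic x)]
    · refine Finset.sum_congr rfl fun y hy => ?_
      rw [Finset.filter_filter]
      congr 1
      refine Finset.filter_congr fun π _ => ⟨?_, fun h => ⟨h.1.1, h.2⟩⟩
      rintro ⟨h, rfl⟩
      exact ⟨⟨h, Finset.mem_Iic.1 hy⟩, rfl⟩
    · intro π hπ
      simpa using (by simpa using hπ : P π ∧ s π ≤ x).2
  refine congrFun (eq_of_sum_Iic_eq (f := fun x => (Finset.univ.filter fun π :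
    Equiv.Perm (Fin (N + 1)) => (colorWord π = c ∧ π 0 = k) ∧
      (innerDescents π, inverseDescentSet π) = x).card)
    (g := fun x => (Finset.univ.filter fun π : Equiv.Perm (Fin (N + 1)) =>
      ((fun i => colorWord π (-i)) = c ∧ π 0 = k) ∧
        (reversedInnerDescents π, inverseDescentSet π) = x).card) fun x => ?_) x
  have := card_innerDescents_subset k c x.1 x.2
  have h1 := sum_Iic (fun π => colorWord π = c ∧ π 0 = k)
    (fun π => (innerDescents π, inverseDescentSet π)) x
  have h2 := sum_Iic (fun π => (fun i => colorWord π (-i)) = c ∧ π 0 = k)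
    (fun π => (reversedInnerDescents π, inverseDescentSet π)) x
  simp only [Prod.le_def] at h1 h2
  convert h1.trans (this.trans h2.symm)

/-- There is a bijection that reverses the order of the letters after the first one, as far as
descents are concerned, and preserves the first letter and the inverse descent set. -/
theorem exists_reversal (N : ℕ) : ∃ Φ : Equiv.Perm (Equiv.Perm (Fin (N + 1))), ∀ π,
    (∀ i, colorWord (Φ π) (-i) = colorWord π i) ∧ Φ π 0 = π 0 ∧
      reversedInnerDescents (Φ π) = innerDescents π ∧
      inverseDescentSet (Φ π) = inverseDescentSet π := by
  classical
  let s : Equiv.Perm (Fin (N + 1)) → ((Fin (N + 1) → Ordering) × Fin (N + 1)) ×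
    (Finset ℕ × Finset ℕ) := fun π => ((colorWord π, π 0), innerDescents π, inverseDescentSet π)
  let t : Equiv.Perm (Fin (N + 1)) → ((Fin (N + 1) → Ordering) × Fin (N + 1)) ×
    (Finset ℕ × Finset ℕ) := fun π =>
      ((fun i => colorWord π (-i), π 0), reversedInnerDescents π, inverseDescentSet π)
  -- Fibers of equal size are matched arbitrarily; the bijection is not explicit.
  have e : ∀ x, Nonempty ({π // s π = x} ≃ {π // t π = x}) := by
    rintro ⟨⟨c, k⟩, y⟩
    refine Fintype.card_eq.1 ?_
    rw [Fintype.card_subtype, Fintype.card_subtype]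
    simpa only [s, t, Prod.mk.injEq (_, _), Prod.mk.injEq (colorWord _),
      Prod.mk.injEq (fun i => colorWord _ (-i))] using card_innerDescents_eq k c y
  refine ⟨Equiv.ofFiberEquiv fun x => (e x).some, fun π => ?_⟩
  have h := Equiv.ofFiberEquiv_map (fun x => (e x).some) π
  simp only [s, t, Prod.mk.injEq] at h
  exact ⟨congrFun h.1.1, h.1.2, h.2.1, h.2.2⟩

/-! ### The linear relation between STAT, MAJ, des and the first letter -/

/-- The indicator of a descent from position `i` to position `i + 1`, counted from `0`. -/
def descentIndicator {N : ℕ} (π : Equiv.Perm (Fin (N + 1))) (i : ℕ) : ℕ :=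
  if π (i + 1 : ℕ) < π (i : ℕ) then 1 else 0

theorem descentSet_eq {N : ℕ} (π : Equiv.Perm (Fin (N + 1))) :
    descentSet π = ((Finset.range N).filter fun i => π (i + 1 : ℕ) < π (i : ℕ)).image (· + 1) := by
  ext x
  simp only [descentSet, Finset.mem_image, Finset.mem_filter, Finset.mem_univ, true_and,
    Finset.mem_range]
  simp only [letter, add_lt_add_iff_right, Fin.val_fin_lt]
  constructor
  · rintro ⟨i, ⟨j, hj, h⟩, rfl⟩
    refine ⟨i, ⟨by omega, ?_⟩, rfl⟩
    have e : (((i : ℕ) + 1 : ℕ) : Fin (N + 1)) = j := by rw [← hj, Fin.cast_val_eq_self]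
    rwa [e, Fin.cast_val_eq_self]
  · rintro ⟨i, ⟨hi, h⟩, rfl⟩
    exact ⟨(i : ℕ), ⟨(i + 1 : ℕ), by rw [val_natCast_of_le hi, val_natCast_of_le hi.le], h⟩,
      by rw [val_natCast_of_le hi.le]⟩

theorem des_eq_sum {N : ℕ} (π : Equiv.Perm (Fin (N + 1))) :
    des π = ∑ i ∈ Finset.range N, descentIndicator π i := by
  rw [des, descentSet_eq, Finset.card_image_of_injective _ (add_left_injective 1),
    Finset.card_filter]
  rfl

theorem MAJ_eq_sum {N : ℕ} (π : Equiv.Perm (Fin (N + 1))) :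
    MAJ π = ∑ i ∈ Finset.range N, (i + 1) * descentIndicator π i := by
  rw [MAJ, descentSet_eq, Finset.sum_image (fun _ _ _ _ h => add_left_injective 1 h),
    Finset.sum_filter]
  exact Finset.sum_congr rfl fun i _ => by simp [descentIndicator]

theorem occurrences_two {N : ℕ} (π : Equiv.Perm (Fin (N + 1))) :
    occurrences ![2, 1] {0} π = ∑ i ∈ Finset.range N, descentIndicator π i := by
  unfold descentIndicator occurrences
  rw [← Finset.card_filter]
  symm
  refine Finset.card_bij (fun i _ => ![((i : ℕ) : Fin (N + 1)), ((i + 1 : ℕ) : Fin (N + 1))])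
    ?_ ?_ ?_
  · intro i hi
    simp only [Finset.mem_filter, Finset.mem_range] at hi
    have h1 := natCast_lt_natCast hi.1 (Nat.lt_succ_self i)
    simp only [Finset.mem_filter, Finset.mem_univ, true_and, IsOccurrence, Fin.forall_fin_two,
      letter, add_lt_add_iff_right, Fin.val_fin_lt, Finset.mem_singleton]
    simp [-Nat.cast_add, hi.2, hi.2.le, h1]
    rw [Nat.mod_eq_of_lt (by omega), Nat.mod_eq_of_lt (by omega)]
  · intro i hi j hj h
    simp only [Finset.mem_filter, Finset.mem_range] at hi hj
    have := congrArg Fin.val (congrFun h 0)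
    simpa [val_natCast_of_le hi.1.le, val_natCast_of_le hj.1.le] using this
  · intro e he
    simp only [Finset.mem_filter, Finset.mem_univ, true_and, IsOccurrence, letter,
      add_lt_add_iff_right, Fin.val_fin_lt] at he
    have h1 := he.2.2 0 (by simp) 1 rfl
    have h2 := (he.2.1 1 0).2 (by simp)
    have e0 : (((e 0 : ℕ) + 1 : ℕ) : Fin (N + 1)) = e 1 := by rw [← h1, Fin.cast_val_eq_self]
    refine ⟨e 0, ?_, ?_⟩
    · simp only [Finset.mem_filter, Finset.mem_range]
      refine ⟨by omega, ?_⟩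
      rwa [e0, Fin.cast_val_eq_self]
    · funext i
      fin_cases i
      · simp
      · simpa [-Nat.cast_add] using e0

theorem occurrences_three {N : ℕ} (π : Equiv.Perm (Fin (N + 1))) (p : Fin 3 → ℕ) :
    occurrences p {0} π = ∑ l ∈ Finset.range N, ∑ i ∈ Finset.range l,
      if ∀ a b : Fin 3, ![π (i : ℕ), π (i + 1 : ℕ), π (l + 1 : ℕ)] a <
        ![π (i : ℕ), π (i + 1 : ℕ), π (l + 1 : ℕ)] b ↔ p a < p b then 1 else 0 := by
  unfold occurrences
  rw [Finset.sum_sigma', ← Finset.card_filter]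
  symm
  have hv : ∀ i l a, (![π (i : ℕ), π (i + 1 : ℕ), π (l + 1 : ℕ)] : Fin 3 → Fin (N + 1)) a =
      π ((![((i : ℕ) : Fin (N + 1)), ((i + 1 : ℕ) : Fin (N + 1)), ((l + 1 : ℕ) : Fin (N + 1))] :
        Fin 3 → Fin (N + 1)) a) := by
    intro i l a; fin_cases a <;> rfl
  refine Finset.card_bij (fun x _ => ![((x.2 : ℕ) : Fin (N + 1)), ((x.2 + 1 : ℕ) : Fin (N + 1)),
    ((x.1 + 1 : ℕ) : Fin (N + 1))]) ?_ ?_ ?_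
  · rintro ⟨l, i⟩ hx
    simp only [Finset.mem_filter, Finset.mem_sigma, Finset.mem_range] at hx
    obtain ⟨⟨hl, hi⟩, h⟩ := hx
    simp only [Finset.mem_filter, Finset.mem_univ, true_and, IsOccurrence, letter,
      add_lt_add_iff_right, Fin.val_fin_lt, Finset.mem_singleton]
    have h1 := natCast_lt_natCast (N := N) (i := i) (j := i + 1) (by omega) (by omega)
    have h2 := natCast_lt_natCast (N := N) (i := i + 1) (j := l + 1) (by omega) (by omega)
    refine ⟨?_, fun a b => ?_, ?_⟩
    · intro a b hab
      fin_cases a <;> fin_cases b <;>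
        first | exact absurd hab (by decide) | exact h1 | exact h2 | exact h1.trans h2
    · rw [← hv, ← hv]; exact h a b
    · rintro a rfl b hb
      have : b = 1 := Fin.ext hb
      subst this
      change (((i + 1 : ℕ) : Fin (N + 1)) : ℕ) = ((i : ℕ) : Fin (N + 1)) + 1
      rw [val_natCast_of_le (by omega), val_natCast_of_le (by omega)]
  · rintro ⟨l, i⟩ hx ⟨l', i'⟩ hx' h
    simp only [Finset.mem_filter, Finset.mem_sigma, Finset.mem_range] at hx hx'
    have h0 : (((i : ℕ) : Fin (N + 1)) : ℕ) = ((i' : ℕ) : Fin (N + 1)) :=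
      congrArg Fin.val (congrFun h 0)
    have h2 : (((l + 1 : ℕ) : Fin (N + 1)) : ℕ) = ((l' + 1 : ℕ) : Fin (N + 1)) :=
      congrArg Fin.val (congrFun h 2)
    rw [val_natCast_of_le (by omega), val_natCast_of_le (by omega)] at h0 h2
    obtain rfl := h0
    obtain rfl : l = l' := by omega
    rfl
  · intro e he
    simp only [Finset.mem_filter, Finset.mem_univ, true_and, IsOccurrence, letter,
      add_lt_add_iff_right, Fin.val_fin_lt] at he
    have h1 := he.2.2 0 (by simp) 1 rfl
    have h2 : (e 1 : ℕ) < e 2 := he.1 1 2 (by decide)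
    have hf : ![(((e 0 : ℕ) : ℕ) : Fin (N + 1)), (((e 0 : ℕ) + 1 : ℕ) : Fin (N + 1)),
        (((e 2 : ℕ) - 1 + 1 : ℕ) : Fin (N + 1))] = e := by
      funext a
      fin_cases a
      · exact Fin.cast_val_eq_self _
      · change (((e 0 : ℕ) + 1 : ℕ) : Fin (N + 1)) = e 1
        rw [← h1, Fin.cast_val_eq_self]
      · change (((e 2 : ℕ) - 1 + 1 : ℕ) : Fin (N + 1)) = e 2
        rw [Nat.sub_add_cancel (by omega), Fin.cast_val_eq_self]
    refine ⟨⟨(e 2 : ℕ) - 1, e 0⟩, ?_, hf⟩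
    simp only [Finset.mem_filter, Finset.mem_sigma, Finset.mem_range]
    refine ⟨⟨by omega, by omega⟩, fun a b => ?_⟩
    rw [hv, hv, hf]
    exact he.2.1 a b

/-- For adjacent `x`, `y` and fixed `z` the last bracket telescopes along the word; this is what
makes STAT linear in the descent indicators. -/
theorem vincular_indicator_sum {α : Type*} [LinearOrder α] {x y z : α} (hxy : x ≠ y) (hyz : y ≠ z)
    (hxz : x ≠ z) :
    ((if ∀ a b : Fin 3, ![x, y, z] a < ![x, y, z] b ↔
        (![1, 3, 2] : Fin 3 → ℕ) a < (![1, 3, 2] : Fin 3 → ℕ) b then 1 else 0) +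
      (if ∀ a b : Fin 3, ![x, y, z] a < ![x, y, z] b ↔
        (![2, 1, 3] : Fin 3 → ℕ) a < (![2, 1, 3] : Fin 3 → ℕ) b then 1 else 0) +
      (if ∀ a b : Fin 3, ![x, y, z] a < ![x, y, z] b ↔
        (![3, 2, 1] : Fin 3 → ℕ) a < (![3, 2, 1] : Fin 3 → ℕ) b then 1 else 0) : ℤ) =
    (if y < x then 1 else 0) + ((if z < y then 1 else 0) - if z < x then 1 else 0) := by
  simp only [Fin.forall_fin_succ]
  rcases lt_or_gt_of_ne hxy with h1 | h1 <;> rcases lt_or_gt_of_ne hyz with h2 | h2 <;>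
    rcases lt_or_gt_of_ne hxz with h3 | h3 <;>
    first
    | exact absurd (h1.trans h2) (not_lt.2 h3.le)
    | exact absurd (h2.trans h1) (not_lt.2 h3.le)
    | simp [h1, h2, h3, h1.not_gt, h2.not_gt, h3.not_gt]

theorem sum_lt_apply_zero {N : ℕ} (π : Equiv.Perm (Fin (N + 1))) :
    ∑ l ∈ Finset.range N, (if π (l + 1 : ℕ) < π 0 then 1 else 0 : ℤ) = (π 0 : ℕ) := by
  have h : ∑ l ∈ Finset.range (N + 1), (if π (l : ℕ) < π 0 then 1 else 0 : ℤ) = (π 0 : ℕ) := by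
    rw [← Fin.sum_univ_eq_sum_range (fun l => (if π (l : ℕ) < π 0 then 1 else 0 : ℤ))]
    simp only [Fin.cast_val_eq_self]
    rw [Equiv.sum_comp π (fun v => (if v < π 0 then 1 else 0 : ℤ)), Finset.sum_boole]
    congr 1
    rw [← Fin.card_Iio (π 0)]
    congr 1
    ext v; simp
  rw [Finset.sum_range_succ'] at h
  simpa using h

theorem STAT_add_MAJ {N : ℕ} (π : Equiv.Perm (Fin (N + 1))) :
    (STAT π : ℤ) + MAJ π + (π 0 : ℕ) = (N + 2) * des π := by
  have hne : ∀ i j : ℕ, i < j → j ≤ N → π (i : ℕ) ≠ π (j : ℕ) := fun i j hij hj h =>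
    (natCast_lt_natCast hj hij).ne (π.injective h)
  have h3 : ((occurrences ![1, 3, 2] {0} π + occurrences ![2, 1, 3] {0} π +
      occurrences ![3, 2, 1] {0} π : ℕ) : ℤ) =
      ∑ l ∈ Finset.range N, (∑ i ∈ Finset.range (l + 1), (descentIndicator π i : ℤ) -
        if π (l + 1 : ℕ) < π 0 then 1 else 0) := by
    simp only [occurrences_three]
    push_cast [-Nat.cast_add, -Nat.cast_succ]
    rw [← Finset.sum_add_distrib, ← Finset.sum_add_distrib]
    refine Finset.sum_congr rfl fun l hl => ?_
    have hl := Finset.mem_range.1 hl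
    rw [← Finset.sum_add_distrib, ← Finset.sum_add_distrib]
    have : ∀ i ∈ Finset.range l, _ = _ := fun i hi => vincular_indicator_sum
      (hne i (i + 1) (by omega) (by have := Finset.mem_range.1 hi; omega))
      (hne (i + 1) (l + 1) (by have := Finset.mem_range.1 hi; omega) (by omega))
      (hne i (l + 1) (by have := Finset.mem_range.1 hi; omega) (by omega))
    rw [Finset.sum_congr rfl this, Finset.sum_add_distrib,
      Finset.sum_range_sub (fun i => (if π (l + 1 : ℕ) < π (i : ℕ) then 1 else 0 : ℤ)),
      Finset.sum_range_succ]
    simp [descentIndicator, -Nat.cast_add]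
    ring
  -- In the double sum the indicator at `i` occurs `m - i` times, which complements its weight `i +
  -- 1` in MAJ.
  have hsum : ∀ m : ℕ, ∑ l ∈ Finset.range m, ∑ i ∈ Finset.range (l + 1),
      (descentIndicator π i : ℤ) + ∑ i ∈ Finset.range m, ((i : ℤ) + 1) * descentIndicator π i =
      (m + 1) * ∑ i ∈ Finset.range m, (descentIndicator π i : ℤ) := by
    intro m
    induction m with
    | zero => simp
    | succ m ih =>
      rw [Finset.sum_range_succ, Finset.sum_range_succ (n := m) (f := fun i : ℕ =>
        ((i : ℤ) + 1) * descentIndicator π i)]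
      simp only [Finset.sum_range_succ (n := m) (f := fun i : ℕ => (descentIndicator π i : ℤ))]
      push_cast
      linear_combination ih
  have hS : (STAT π : ℤ) = (des π : ℤ) + ((occurrences ![1, 3, 2] {0} π +
      occurrences ![2, 1, 3] {0} π + occurrences ![3, 2, 1] {0} π : ℕ) : ℤ) := by
    rw [STAT, occurrences_two, ← des_eq_sum]; push_cast; ring
  rw [hS, h3, Finset.sum_sub_distrib, sum_lt_apply_zero, MAJ_eq_sum, des_eq_sum]
  push_cast
  linear_combination hsum N

/-! ### Effect of the reversal on des and MAJ -/

theorem neg_natCast_eq {N l m : ℕ} (h : l + m = N + 1) :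
    (-(l : ℕ) : Fin (N + 1)) = (m : ℕ) := by
  rw [neg_eq_iff_add_eq_zero, ← Nat.cast_add, h]
  simp

/-- Between equal colours the descents correspond by `hD`. At a colour change exactly one of the two
words descends, and the colours tell which. -/
theorem descentIndicator_sub_reversal {N : ℕ} {π ρ : Equiv.Perm (Fin (N + 1))}
    (hc : ∀ i, colorWord ρ (-i) = colorWord π i) (h0 : ρ 0 = π 0)
    (hD : reversedInnerDescents ρ = innerDescents π) {l : ℕ} (hl0 : l ≠ 0) (hl : l < N) :
    (descentIndicator π l : ℤ) - descentIndicator ρ (N - l) =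
      (if π (l + 1 : ℕ) < π 0 then 1 else 0) - if π (l : ℕ) < π 0 then 1 else 0 := by
  have hd : descentIndicator ρ (N - l) =
      if ρ (-(l : ℕ)) < ρ (-(l + 1 : ℕ)) then 1 else 0 := by
    rw [descentIndicator, neg_natCast_eq (m := N - l + 1) (by omega),
      neg_natCast_eq (m := N - l) (by omega)]
  have hne : ∀ j : ℕ, j ≠ 0 → j ≤ N → π (j : ℕ) ≠ π 0 := fun j hj hjN h => by
    have := natCast_lt_natCast hjN (Nat.pos_of_ne_zero hj)
    simp [π.injective h] at this
  have hlt : ∀ i, ρ (-i) < π 0 ↔ π i < π 0 := fun i => by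
    rw [← cmp_eq_lt_iff, ← cmp_eq_lt_iff]
    have := hc i
    rw [colorWord, colorWord, h0] at this
    rw [this]
  have hgt : ∀ i, π 0 < ρ (-i) ↔ π 0 < π i := fun i => by
    rw [← cmp_eq_gt_iff, ← cmp_eq_gt_iff]
    have := hc i
    rw [colorWord, colorWord, h0] at this
    rw [this]
  have hsame : colorWord π (l : ℕ) = colorWord π (l + 1 : ℕ) →
      (ρ (-(l : ℕ)) < ρ (-(l + 1 : ℕ)) ↔ π (l + 1 : ℕ) < π (l : ℕ)) := fun h => by
    have := Finset.ext_iff.1 hD l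
    simpa only [reversedInnerDescents, innerDescents, Finset.mem_filter, Finset.mem_range, hl,
      hl0, hc, h, ne_eq, not_false_eq_true, true_and] using this
  rw [hd, descentIndicator]
  rcases lt_or_gt_of_ne (hne l hl0 hl.le) with h1 | h1 <;>
    rcases lt_or_gt_of_ne (hne (l + 1) (by omega) hl) with h2 | h2
  · rw [if_congr (hsame (by rw [colorWord, colorWord, (cmp_eq_lt_iff _ _).2 h1, (cmp_eq_lt_iff _ _).2 h2])) rfl rfl]
    simp [-Nat.cast_add, h1, h2]
  · have h3 := ((hlt _).2 h1).trans ((hgt _).2 h2)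
    simp [-Nat.cast_add, h1, h2.not_gt, (h1.trans h2).not_gt, h3]
  · have h3 := ((hlt _).2 h2).trans ((hgt _).2 h1)
    simp [-Nat.cast_add, h2, h1.not_gt, h2.trans h1, h3.not_gt]
  · rw [if_congr (hsame (by rw [colorWord, colorWord, (cmp_eq_gt_iff _ _).2 h1, (cmp_eq_gt_iff _ _).2 h2])) rfl rfl]
    simp [-Nat.cast_add, h1.not_gt, h2.not_gt]

theorem des_and_MAJ_reversal {N : ℕ} {π ρ : Equiv.Perm (Fin (N + 1))}
    (hc : ∀ i, colorWord ρ (-i) = colorWord π i) (h0 : ρ 0 = π 0)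
    (hD : reversedInnerDescents ρ = innerDescents π) :
    des ρ = des π ∧ (MAJ ρ : ℤ) + MAJ π + (π 0 : ℕ) = (N + 2) * des π := by
  obtain _ | M := N
  · have := (π 0).isLt
    simp [des_eq_sum, MAJ_eq_sum]
  have key : ∀ i ∈ Finset.range M, (descentIndicator π (i + 1) : ℤ) -
      descentIndicator ρ (M - 1 - i + 1) = (if π (i + 1 + 1 : ℕ) < π 0 then 1 else 0) -
        if π (i + 1 : ℕ) < π 0 then 1 else 0 := by
    intro i hi
    have hi := Finset.mem_range.1 hi
    rw [← descentIndicator_sub_reversal hc h0 hD (l := i + 1) (by omega) (by omega)]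
    congr 3; omega
  have first : ∀ τ : Equiv.Perm (Fin (M + 1 + 1)), (descentIndicator τ 0 : ℤ) =
      if τ (0 + 1 : ℕ) < τ 0 then 1 else 0 := fun τ => by
    simp [descentIndicator]
  -- The second letter of `ρ` has the colour of the last letter of `π`.
  have last : (if ρ (0 + 1 : ℕ) < ρ 0 then 1 else 0 : ℤ) =
      if π (M + 1 : ℕ) < π 0 then 1 else 0 := by
    have := hc (M + 1 : ℕ)
    rw [neg_natCast_eq (m := 0 + 1) (by omega), colorWord, colorWord] at this
    simp only [← cmp_eq_lt_iff, this]
  have hk := sum_lt_apply_zero π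
  have tele := Finset.sum_range_sub
    (fun i : ℕ => (if π (i + 1 : ℕ) < π 0 then 1 else 0 : ℤ)) M
  -- Summation by parts; `i + 2` is the weight in MAJ of a descent at index `i + 1`.
  have abel : ∀ (t : ℕ → ℤ) (m : ℕ), ∑ i ∈ Finset.range m, ((i : ℤ) + 2) * (t (i + 1) - t i) +
      ∑ i ∈ Finset.range (m + 1), t i = (m + 2) * t m - t 0 := by
    intro t m
    induction m with
    | zero => simp; ring
    | succ m ih =>
      rw [Finset.sum_range_succ, Finset.sum_range_succ (n := m + 1)]
      push_cast
      linear_combination ih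
  have habel := abel (fun i : ℕ => (if π (i + 1 : ℕ) < π 0 then 1 else 0 : ℤ)) M
  rw [hk] at habel
  beta_reduce at tele
  rw [← Finset.sum_congr rfl key] at tele
  rw [← Finset.sum_congr rfl fun (i : ℕ) hi => congrArg (((i : ℤ) + 2) * ·) (key i hi)] at habel
  have desr : ((des ρ : ℕ) : ℤ) = ∑ i ∈ Finset.range M, (descentIndicator ρ (M - 1 - i + 1) : ℤ) +
      if π (M + 1 : ℕ) < π 0 then 1 else 0 := by
    rw [des_eq_sum, Finset.sum_range_succ', ← Finset.sum_range_reflect, Nat.cast_add, first, last,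
      Nat.cast_sum]
  have desp : ((des π : ℕ) : ℤ) = ∑ i ∈ Finset.range M, (descentIndicator π (i + 1) : ℤ) +
      if π (0 + 1 : ℕ) < π 0 then 1 else 0 := by
    rw [des_eq_sum, Finset.sum_range_succ', Nat.cast_add, first, Nat.cast_sum]
  -- Corresponding places in `π` and `ρ` have weights with sum `M + 3`, the coefficient of des.
  have majr : ((MAJ ρ : ℕ) : ℤ) = ∑ i ∈ Finset.range M, ((M : ℤ) + 3 - (i + 2)) *
      (descentIndicator ρ (M - 1 - i + 1) : ℤ) + if π (M + 1 : ℕ) < π 0 then 1 else 0 := by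
    rw [MAJ_eq_sum, Finset.sum_range_succ', ← Finset.sum_range_reflect, Nat.cast_add, zero_add,
      one_mul, first, last, Nat.cast_sum]
    congr 1
    refine Finset.sum_congr rfl fun i hi => ?_
    have hi := Finset.mem_range.1 hi
    have e : ((M - 1 - i + 1 + 1 : ℕ) : ℤ) = (M : ℤ) + 3 - (i + 2) := by omega
    rw [Nat.cast_mul, e]
  have majp : ((MAJ π : ℕ) : ℤ) = ∑ i ∈ Finset.range M, ((i : ℤ) + 2) *
      (descentIndicator π (i + 1) : ℤ) + if π (0 + 1 : ℕ) < π 0 then 1 else 0 := by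
    rw [MAJ_eq_sum, Finset.sum_range_succ', Nat.cast_add, zero_add, one_mul, first, Nat.cast_sum]
    congr 1
  simp only [sub_mul, mul_sub, Finset.sum_sub_distrib, ← Finset.mul_sum] at tele habel majr
  have hdes : (des ρ : ℤ) = des π := by linear_combination desr - desp - tele
  refine ⟨by exact_mod_cast hdes, ?_⟩
  push_cast
  linear_combination majr + majp + habel - (M + 3) * desr + (M + 3) * hdes

theorem exists_MAJ_STAT_exchange (N : ℕ) : ∃ Φ : Equiv.Perm (Equiv.Perm (Fin (N + 1))), ∀ π,
    des (Φ π) = des π ∧ inverseDescentSet (Φ π) = inverseDescentSet π ∧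
      firstLetter (Φ π) = firstLetter π ∧ MAJ (Φ π) = STAT π ∧ STAT (Φ π) = MAJ π := by
  obtain ⟨Φ, hΦ⟩ := exists_reversal N
  refine ⟨Φ, fun π => ?_⟩
  obtain ⟨hc, h0, hD, hI⟩ := hΦ π
  obtain ⟨h1, h2⟩ := des_and_MAJ_reversal hc h0 hD
  have h3 := STAT_add_MAJ π
  have h4 := STAT_add_MAJ (Φ π)
  rw [h0, h1] at h4
  refine ⟨h1, hI, ?_, by omega, by omega⟩
  rw [firstLetter, firstLetter, dif_pos N.succ_pos, dif_pos N.succ_pos, letter, letter]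
  exact congrArg (fun x : Fin (N + 1) => (x : ℕ) + 1) h0

end

end PermStat

theorem mainTheorem1 (n : ℕ) (d : ℕ) (S : Finset ℕ) (f a b : ℕ) :
    (Finset.univ.filter fun π : Equiv.Perm (Fin n) =>
      PermStat.des π = d ∧ PermStat.inverseDescentSet π = S ∧ PermStat.firstLetter π = f ∧
        PermStat.MAJ π = a ∧ PermStat.STAT π = b).card =
    (Finset.univ.filter fun π : Equiv.Perm (Fin n) =>
      PermStat.des π = d ∧ PermStat.inverseDescentSet π = S ∧ PermStat.firstLetter π = f ∧
        PermStat.STAT π = a ∧ PermStat.MAJ π = b).card := by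
  obtain _ | N := n
  -- On the empty word both statistics vanish.
  · have h : ∀ π : Equiv.Perm (Fin 0), PermStat.MAJ π = PermStat.STAT π := by decide
    simp only [h]
  · obtain ⟨Φ, hΦ⟩ := PermStat.exists_MAJ_STAT_exchange N
    refine Finset.card_equiv Φ fun π => ?_
    obtain ⟨h1, h2, h3, h4, h5⟩ := hΦ π
    simp only [Finset.mem_filter, Finset.mem_univ, true_and, h1, h2, h3, h4, h5]
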